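/- Let $\Omega=(0,1)\times(0,1)$. For a conforming triangulation $\mathcal T$ of $\overline\Omega$ with set of nodes $\mathcal N$ (boundary nodes included), let $(\lambda_p)_{p\in\mathcal N}$ be the nodal basis of the space of continuous functions on $\overline\Omega$ that are affine on each triangle, and put $$M=\Big(\int_\Omega\lambda_p\lambda_q\Big)_{p,q},\quad K=\Big(\int_\Omega\nabla\lambda_p\cdot\nabla\lambda_q\Big)_{p,q},\quad m=\Big(\int_\Omega\lambda_p\Big)_{p},\quad \bar K=K+mm^T .$$ For $\eta>0$ let $$\mathcal P=\begin{pmatrix}\bar K+\eta^{-1/2}M&0\\0&\eta\bar K+\eta^{1/2}M\end{pmatrix},\qquad \mathcal A=\begin{pmatrix}\bar K&M\\M&-\eta\bar K\end{pmatrix}.$$ Then $\mathcal P$ is symmetric positive definite, $\mathcal A$ is nonsingular, and the condition number of the preconditioned operator $T=\mathcal P^{-1}\mathcal A$ is $O(1)$, uniformly in the mesh and in $\eta$: there is an absolute constant $C$ such that, for every such triangulation $\mathcal T$ and every $\eta>0$, $$\kappa_{\mathcal P}(T)=\|T\|_{\mathcal P}\,\|T^{-1}\|_{\mathcal P}\le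 C \qquad\text{and}\qquad \rho(T)\,\rho(T^{-1})=\frac{\max\{|\lambda|:\lambda\in\sigma(T)\}}{\min\{|\lambda|:\lambda\in\sigma(T)\}}\le C .$$ Here $\|\cdot\|_{\mathcal P}$ is the operator norm induced by the norm $\|z\|_{\mathcal P}=(z^T\mathcal Pz)^{1/2}$, $\rho$ is the spectral radius and $\sigma$ the spectrum. -/

import Mathlib

open MeasureTheory
open scoped ENNReal NNReal Matrix

noncomputable section

namespace CahnHilliardFEM

/-! ### The domain, triangulations and linear finite elements -/

/-- The Euclidean plane. -/
abbrev Plane : Type := EuclideanSpace ℝ (Fin 2)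

/-- The domain `Ω = (0,1) × (0,1)`. -/
def unitSquare : Set Plane := {x | ∀ i, 0 < x i ∧ x i < 1}

/-- The closure of the domain, `[0,1] × [0,1]`. -/
def closedUnitSquare : Set Plane := {x | ∀ i, 0 ≤ x i ∧ x i ≤ 1}

/-- A conforming triangulation of the closed unit square: a finite geometric simplicial complex
(nondegenerate simplices which meet only in common faces) whose simplices cover exactly the closed
unit square. -/
structure Triangulation where
  complex : Geometry.SimplicialComplex ℝ Plane
  finite_faces : complex.faces.Finite
  space_eq : complex.space = closedUnitSquare

namespace Triangulation

variable (𝒯 : Triangulation)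

/-- The set `𝒩_h` of all nodes of the triangulation, including those on the boundary. -/
abbrev Node : Type := 𝒯.complex.vertices

theorem finite_vertices : 𝒯.complex.vertices.Finite :=
  Set.Finite.preimage (f := fun x : Plane => ({x} : Finset Plane))
    (fun _ _ _ _ h => Finset.singleton_injective h) 𝒯.finite_faces

instance instFintypeNode : Fintype 𝒯.Node := 𝒯.finite_vertices.fintype

/-- The linear finite element space `𝒮_h`: functions which are continuous on the closed square and
affine on each simplex of the triangulation. -/
def linearElements : Set (Plane → ℝ) :=
  {v | ContinuousOn v closedUnitSquare ∧
    ∀ s ∈ 𝒯.complex.faces, ∃ a : Plane →ᵃ[ℝ] ℝ, Set.EqOn v a (convexHull ℝ (s : Set Plane))}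

/-- `w` is the system of barycentric coordinates of the point `x` with respect to the nodes: for
some simplex `s` of the triangulation, `x = ∑ w q • q` is a convex combination of the vertices of
`s`, and `w` vanishes off `s`. -/
def IsBarycentric (x : Plane) (w : Plane → ℝ) : Prop :=
  ∃ s ∈ 𝒯.complex.faces, (∀ q ∈ s, 0 ≤ w q) ∧ (∀ q ∉ s, w q = 0) ∧
    ∑ q ∈ s, w q = 1 ∧ ∑ q ∈ s, w q • q = x

open Classical in
/-- The nodal basis ("hat") function `λ_p`: its value at a point `x` of the closed square is the
barycentric coordinate of `x` with respect to the node `p`. It is set to `0` off the closed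
square. -/
def hat (p : 𝒯.Node) (x : Plane) : ℝ :=
  if h : ∃ w, 𝒯.IsBarycentric x w then h.choose p else 0

theorem isBarycentric_eq_of_face {s : Finset Plane} (hs : s ∈ 𝒯.complex.faces)
    {w w' : Plane → ℝ} (hw : ∀ q ∉ s, w q = 0) (hw' : ∀ q ∉ s, w' q = 0)
    (h1 : ∑ q ∈ s, w q = ∑ q ∈ s, w' q) (h2 : ∑ q ∈ s, w q • q = ∑ q ∈ s, w' q • q) : w = w' := by
  funext q
  by_cases hq : q ∈ s
  · have := (𝒯.complex.indep hs).eq_of_sum_eq_sum (s := Finset.univ)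
      (w₁ := fun i : s => w i) (w₂ := fun i : s => w' i)
      (by rw [Finset.sum_coe_sort s w, Finset.sum_coe_sort s w', h1])
      (by rw [Finset.sum_coe_sort s (fun q => w q • q), Finset.sum_coe_sort s (fun q => w' q • q), h2])
      ⟨q, hq⟩ (Finset.mem_univ _)
    exact this
  · rw [hw q hq, hw' q hq]

theorem IsBarycentric.unique {x : Plane} {w w' : Plane → ℝ}
    (h : 𝒯.IsBarycentric x w) (h' : 𝒯.IsBarycentric x w') : w = w' := by
  classical
  obtain ⟨s, hs, h0, hz, h1, hx⟩ := h
  obtain ⟨t, ht, h0', hz', h1', hx'⟩ := h'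
  have hxs : x ∈ convexHull ℝ (s : Set Plane) := Finset.mem_convexHull'.2 ⟨w, h0, h1, hx⟩
  have hxt : x ∈ convexHull ℝ (t : Set Plane) := Finset.mem_convexHull'.2 ⟨w', h0', h1', hx'⟩
  have hst := 𝒯.complex.inter_subset_convexHull hs ht ⟨hxs, hxt⟩
  rw [← Finset.coe_inter, Finset.mem_convexHull'] at hst
  obtain ⟨v, -, hv1, hvx⟩ := hst
  set u : Plane → ℝ := fun q => if q ∈ s ∩ t then v q else 0 with hu
  have key : ∀ r : Finset Plane, s ∩ t ⊆ r → ∑ q ∈ r, u q = 1 ∧ ∑ q ∈ r, u q • q = x := by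
    intro r hr
    constructor
    · rw [← hv1, ← Finset.sum_subset hr]
      · exact Finset.sum_congr rfl fun q hq => by simp only [hu]; rw [if_pos hq]
      · intro q _ hq; simp only [hu]; rw [if_neg hq]
    · rw [← hvx, ← Finset.sum_subset hr]
      · exact Finset.sum_congr rfl fun q hq => by simp only [hu]; rw [if_pos hq]
      · intro q _ hq; simp only [hu]; rw [if_neg hq, zero_smul]
  have e1 : w = u := isBarycentric_eq_of_face 𝒯 hs hz
    (fun q hq => by simp only [hu]; rw [if_neg (fun h => hq (Finset.mem_inter.1 h).1)])
    (by rw [h1, (key s Finset.inter_subset_left).1])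
    (by rw [hx, (key s Finset.inter_subset_left).2])
  have e2 : w' = u := isBarycentric_eq_of_face 𝒯 ht hz'
    (fun q hq => by simp only [hu]; rw [if_neg (fun h => hq (Finset.mem_inter.1 h).2)])
    (by rw [h1', (key t Finset.inter_subset_right).1])
    (by rw [hx', (key t Finset.inter_subset_right).2])
  rw [e1, e2]

theorem hat_eq {x : Plane} {w : Plane → ℝ} (h : 𝒯.IsBarycentric x w) (p : 𝒯.Node) :
    𝒯.hat p x = w p := by
  have hex : ∃ w, 𝒯.IsBarycentric x w := ⟨w, h⟩
  rw [hat, dif_pos hex, IsBarycentric.unique 𝒯 hex.choose_spec h]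

/-- The hat functions are nodal: `λ_p (q) = δ_pq`. -/
theorem hat_node (p q : 𝒯.Node) : 𝒯.hat p q = if p = q then 1 else 0 := by
  classical
  have h : 𝒯.IsBarycentric q (fun r => if r = q then 1 else 0) :=
    ⟨{(q : Plane)}, q.2, by simp, by simp, by simp, by simp⟩
  rw [hat_eq 𝒯 h]
  simp [Subtype.ext_iff]

theorem hat_affine (p : 𝒯.Node) {s : Finset Plane} (hs : s ∈ 𝒯.complex.faces) :
    ∃ a : Plane →ᵃ[ℝ] ℝ, Set.EqOn (𝒯.hat p) a (convexHull ℝ (s : Set Plane)) := by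
  classical
  obtain ⟨t, hst, ht, htop⟩ := exists_subset_affineIndependent_affineSpan_eq_top
    (k := ℝ) (s := (s : Set Plane)) (𝒯.complex.indep hs)
  let b : AffineBasis t ℝ Plane := ⟨Subtype.val, ht, by simpa using htop⟩
  have main : ∀ (x : Plane) (w : Plane → ℝ), (∀ q ∈ s, 0 ≤ w q) → (∑ q ∈ s, w q = 1) →
      (∑ q ∈ s, w q • q = x) → 𝒯.hat p x = if (p : Plane) ∈ s then w p else 0 := by
    intro x w h0 h1 hx
    refine hat_eq 𝒯 (w := fun q => if q ∈ s then w q else 0)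
      ⟨s, hs, fun q hq => by simpa [hq] using h0 q hq, fun q hq => by simp [hq], ?_, ?_⟩ p
    · rw [← h1]; exact Finset.sum_congr rfl fun q hq => by simp [hq]
    · rw [← hx]; exact Finset.sum_congr rfl fun q hq => by simp [hq]
  by_cases hp : (p : Plane) ∈ s
  · refine ⟨b.coord ⟨p, hst hp⟩, fun x hx => ?_⟩
    obtain ⟨w, h0, h1, hx⟩ := Finset.mem_convexHull'.1 hx
    rw [main x w h0 h1 hx, if_pos hp, ← hx,
      ← Finset.affineCombination_eq_linear_combination s (fun q => q) w h1,
      Finset.map_affineCombination _ _ _ h1,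
      Finset.affineCombination_eq_linear_combination _ _ _ h1]
    rw [Finset.sum_eq_single (p : Plane)]
    · have : b.coord ⟨p, hst hp⟩ (b ⟨p, hst hp⟩) = 1 := b.coord_apply_eq _
      have hb : b ⟨p, hst hp⟩ = (p : Plane) := rfl
      rw [hb] at this
      simp [this]
    · intro q hq hqp
      have : b.coord ⟨p, hst hp⟩ (b ⟨q, hst hq⟩) = 0 :=
        b.coord_apply_ne (fun h => hqp (Subtype.ext_iff.1 h).symm)
      have hb : b ⟨q, hst hq⟩ = q := rfl
      rw [hb] at this
      simp [this]
    · intro h; exact absurd hp h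
  · refine ⟨AffineMap.const ℝ Plane 0, fun x hx => ?_⟩
    obtain ⟨w, h0, h1, hx⟩ := Finset.mem_convexHull'.1 hx
    rw [main x w h0 h1 hx, if_neg hp]
    simp

/-- The hat functions are linear finite elements. -/
theorem hat_mem_linearElements (p : 𝒯.Node) : 𝒯.hat p ∈ 𝒯.linearElements := by
  refine ⟨?_, fun s hs => 𝒯.hat_affine p hs⟩
  rw [← 𝒯.space_eq, Geometry.SimplicialComplex.space, Set.biUnion_eq_iUnion]
  have := 𝒯.finite_faces.to_subtype
  refine LocallyFinite.continuousOn_iUnion (locallyFinite_of_finite _) ?_ ?_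
  · intro s
    exact ((s : Finset Plane).finite_toSet.isCompact_convexHull ℝ).isClosed
  · intro s
    obtain ⟨a, ha⟩ := 𝒯.hat_affine p s.2
    exact (a.continuous_of_finiteDimensional.continuousOn).congr ha

/-! ### Finite element matrices -/

/-- The mass matrix `M = (∫_Ω λ_p λ_q)`. -/
def mass : Matrix 𝒯.Node 𝒯.Node ℝ :=
  Matrix.of fun p q => ∫ x in unitSquare, 𝒯.hat p x * 𝒯.hat q x

/-- The stiffness matrix `K = (∫_Ω ∇λ_p · ∇λ_q)`. The gradient of the piecewise affine function
`λ_p` exists off the edges of the triangulation, which form a null set. -/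
def stiffness : Matrix 𝒯.Node 𝒯.Node ℝ :=
  Matrix.of fun p q =>
    ∫ x in unitSquare, inner ℝ (gradient (𝒯.hat p) x) (gradient (𝒯.hat q) x)

/-- The vector `m = (∫_Ω λ_p)`. -/
def meanVec : 𝒯.Node → ℝ := fun p => ∫ x in unitSquare, 𝒯.hat p x

/-- The matrix `K̄ = K + m mᵀ`. -/
def stiffnessBar : Matrix 𝒯.Node 𝒯.Node ℝ :=
  𝒯.stiffness + Matrix.vecMulVec 𝒯.meanVec 𝒯.meanVec

/-- The saddle-point matrix `[[K̄, M], [M, -η K̄]]`. -/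
def saddle (η : ℝ) : Matrix (𝒯.Node ⊕ 𝒯.Node) (𝒯.Node ⊕ 𝒯.Node) ℝ :=
  Matrix.fromBlocks 𝒯.stiffnessBar 𝒯.mass 𝒯.mass (-(η • 𝒯.stiffnessBar))

/-- The block diagonal preconditioner `diag(K̄ + η^(-1/2) M, η K̄ + η^(1/2) M)`. -/
def precond (η : ℝ) : Matrix (𝒯.Node ⊕ 𝒯.Node) (𝒯.Node ⊕ 𝒯.Node) ℝ :=
  Matrix.fromBlocks (𝒯.stiffnessBar + η ^ (-(1 / 2) : ℝ) • 𝒯.mass) 0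
    0 (η • 𝒯.stiffnessBar + η ^ (1 / 2 : ℝ) • 𝒯.mass)

/-- The preconditioned operator: inverse of the preconditioner times the saddle-point matrix. -/
def preconditioned (η : ℝ) : Matrix (𝒯.Node ⊕ 𝒯.Node) (𝒯.Node ⊕ 𝒯.Node) ℝ :=
  (𝒯.precond η)⁻¹ * 𝒯.saddle η

end Triangulation

/-! ### Condition numbers -/

section ConditionNumber

variable {ι : Type*} [Fintype ι] [DecidableEq ι]

/-- The norm `‖z‖_P = √(zᵀ P z)` defined by a symmetric positive definite matrix `P`. -/
def energyNorm (P : Matrix ι ι ℝ) (z : ι → ℝ) : ℝ := Real.sqrt (z ⬝ᵥ (P *ᵥ z))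

/-- The operator norm `sup_{z ≠ 0} ‖T z‖_P / ‖z‖_P` of a matrix `T` with respect to the norm
defined by the symmetric positive definite matrix `P`. -/
def energyOpNorm (P T : Matrix ι ι ℝ) : ℝ≥0∞ :=
  ⨆ (z : ι → ℝ) (_ : z ≠ 0), ENNReal.ofReal (energyNorm P (T *ᵥ z) / energyNorm P z)

open Classical in
/-- The condition number `‖T‖_P ‖T⁻¹‖_P` of a matrix `T` with respect to the norm defined by the
symmetric positive definite matrix `P`; it is infinite if `T` is singular. -/
def energyCondNumber (P T : Matrix ι ι ℝ) : ℝ≥0∞ :=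
  if IsUnit T then energyOpNorm P T * energyOpNorm P T⁻¹ else ⊤

open Classical in
/-- The spectral condition number `ρ(T) ρ(T⁻¹) = max |λ| / min |λ|`, with `λ` running over the
complex eigenvalues of the real matrix `T`; it is infinite if `T` is singular. For a symmetric
positive definite matrix it is the usual condition number `λ_max / λ_min`. -/
def spectralCondNumber (T : Matrix ι ι ℝ) : ℝ≥0∞ :=
  if IsUnit T then
    spectralRadius ℂ (T.map (algebraMap ℝ ℂ)) * spectralRadius ℂ (T⁻¹.map (algebraMap ℝ ℂ))
  else ⊤

end ConditionNumber

end CahnHilliardFEM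

end

namespace CahnHilliardFEM

/-! ### Energy-norm bounds and what they imply for condition numbers -/

section ConditionNumber

variable {ι : Type*} [Fintype ι]

/-! The mesh enters only through two facts: `K̄` is positive semidefinite and `M` is positive
definite, since `K` and `M` are Gram matrices in L² of the gradients of the hats and of the linearly
independent hats, and `m mᵀ` is positive semidefinite. The rest is algebra, with r = √η. Write ‖·‖
for the `P`-norm. Since PT = A, wᵀAz is the `P`-inner product of w and Tz. Weighted Young
inequalities give 2wᵀAz ≤ ‖w‖² + ‖z‖² (`two_mul_dotProduct_blockSaddle_mulVec_le`), hence ‖Tz‖ ≤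
‖z‖. An explicit test vector w with wᵀAz = ‖z‖² and ‖w‖² = 2‖z‖²
(`exists_dotProduct_blockSaddle_mulVec_eq`) gives ‖z‖ ≤ √2 ‖Tz‖. Therefore κ ≤ √2, and energy-norm
bounds also control complex eigenvalues (`spectralRadius_map_le`). -/

theorem dotProduct_mulVec_comm_of_isHermitian {S : Matrix ι ι ℝ} (hS : S.IsHermitian)
    (x y : ι → ℝ) : x ⬝ᵥ (S *ᵥ y) = y ⬝ᵥ (S *ᵥ x) := by
  have hT : Sᵀ = S := by simpa using hS.eq
  rw [Matrix.dotProduct_mulVec, ← Matrix.mulVec_transpose, hT, dotProduct_comm]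

theorem dotProduct_mulVec_self_nonneg {S : Matrix ι ι ℝ} (hS : S.PosSemidef) (x : ι → ℝ) :
    0 ≤ x ⬝ᵥ (S *ᵥ x) := by
  simpa using hS.dotProduct_mulVec_nonneg x

/-- Expand the nonnegative form of `S` at `x - c • y`. The free weight `c` balances the powers of r
later on. -/
theorem two_mul_dotProduct_mulVec_le {S : Matrix ι ι ℝ} (hS : S.PosSemidef) (c : ℝ)
    (x y : ι → ℝ) :
    2 * c * (x ⬝ᵥ (S *ᵥ y)) ≤ x ⬝ᵥ (S *ᵥ x) + c ^ 2 * (y ⬝ᵥ (S *ᵥ y)) := by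
  have h := dotProduct_mulVec_self_nonneg hS (x - c • y)
  have hc := dotProduct_mulVec_comm_of_isHermitian hS.isHermitian x y
  simp only [Matrix.mulVec_sub, Matrix.mulVec_smul, sub_dotProduct, dotProduct_sub,
    smul_dotProduct, dotProduct_smul, smul_eq_mul] at h
  rw [← hc] at h
  linarith

theorem energyOpNorm_le {P T : Matrix ι ι ℝ} (hP : P.PosDef) {c : ℝ} (hc : 0 ≤ c)
    (h : ∀ z, (T *ᵥ z) ⬝ᵥ (P *ᵥ (T *ᵥ z)) ≤ c ^ 2 * (z ⬝ᵥ (P *ᵥ z))) :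
    energyOpNorm P T ≤ ENNReal.ofReal c := by
  refine iSup₂_le fun z hz => ENNReal.ofReal_le_ofReal ?_
  have hpos : 0 < energyNorm P z := Real.sqrt_pos.2 (by simpa using hP.dotProduct_mulVec_pos hz)
  rw [div_le_iff₀ hpos, energyNorm, energyNorm, ← Real.sqrt_sq hc,
    ← Real.sqrt_mul (sq_nonneg c)]
  exact Real.sqrt_le_sqrt (h z)

/-- A bound on a real matrix in an energy norm bounds its complex eigenvalues. -/
theorem spectralRadius_map_le [DecidableEq ι] {P T : Matrix ι ι ℝ} (hP : P.PosDef) {c : ℝ}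
    (hc : 0 ≤ c) (h : ∀ z, (T *ᵥ z) ⬝ᵥ (P *ᵥ (T *ᵥ z)) ≤ c ^ 2 * (z ⬝ᵥ (P *ᵥ z))) :
    spectralRadius ℂ (T.map (algebraMap ℝ ℂ)) ≤ ENNReal.ofReal c := by
  refine iSup₂_le fun k hk => ?_
  rw [spectrum.mem_iff, Matrix.isUnit_iff_isUnit_det, isUnit_iff_ne_zero, not_not,
    ← Matrix.exists_mulVec_eq_zero_iff] at hk
  obtain ⟨v, hv, hkv⟩ := hk
  set a : ι → ℝ := fun i => (v i).re with ha
  set b : ι → ℝ := fun i => (v i).im with hb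
  have hTv : (T.map (algebraMap ℝ ℂ)) *ᵥ v = k • v := by
    rw [Matrix.sub_mulVec, Algebra.algebraMap_eq_smul_one, Matrix.smul_mulVec,
      Matrix.one_mulVec, sub_eq_zero] at hkv
    exact hkv.symm
  have hTa : T *ᵥ a = k.re • a - k.im • b := by
    funext i
    have := congrArg Complex.re (congrFun hTv i)
    simpa [Matrix.mulVec, dotProduct, ha, hb] using this
  have hTb : T *ᵥ b = k.re • b + k.im • a := by
    funext i
    have := congrArg Complex.im (congrFun hTv i)
    simpa [Matrix.mulVec, dotProduct, ha, hb] using this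
  have h1 := h a
  have h2 := h b
  have hab := dotProduct_mulVec_comm_of_isHermitian hP.isHermitian a b
  have hpos : 0 < a ⬝ᵥ (P *ᵥ a) + b ⬝ᵥ (P *ᵥ b) := by
    have hna := dotProduct_mulVec_self_nonneg hP.posSemidef a
    have hnb := dotProduct_mulVec_self_nonneg hP.posSemidef b
    by_cases h0 : a = 0
    · have hb0 : b ≠ 0 := fun h0' => hv <| funext fun i =>
        Complex.ext (congrFun h0 i) (congrFun h0' i)
      have : 0 < b ⬝ᵥ (P *ᵥ b) := by simpa using hP.dotProduct_mulVec_pos hb0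
      linarith
    · have : 0 < a ⬝ᵥ (P *ᵥ a) := by simpa using hP.dotProduct_mulVec_pos h0
      linarith
  rw [hTa] at h1
  rw [hTb] at h2
  simp only [Matrix.mulVec_sub, Matrix.mulVec_add, Matrix.mulVec_smul, sub_dotProduct,
    dotProduct_sub, add_dotProduct, dotProduct_add, smul_dotProduct, dotProduct_smul,
    smul_eq_mul] at h1 h2
  rw [← hab] at h1 h2
  -- In the sum of the bounds for `T a` and `T b` the mixed terms in `a`, `b` cancel, leaving |k|²
  -- times the sum of the energies of `a` and `b`.
  have hk2 : k.re ^ 2 + k.im ^ 2 ≤ c ^ 2 := by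
    refine le_of_mul_le_mul_right ?_ hpos
    linarith
  have hnorm : ‖k‖ ≤ c := by
    refine abs_le_of_sq_le_sq' ?_ hc |>.2
    rw [Complex.sq_norm, Complex.normSq_apply]
    linarith
  rw [← enorm_eq_nnnorm, ← ofReal_norm]
  exact ENNReal.ofReal_le_ofReal hnorm

/-- Both condition numbers are bounded by `√2` once `T` is a contraction in the energy norm and
shrinks it by a factor of at most `√2`. -/
theorem isUnit_and_condNumber_le [DecidableEq ι] {P T : Matrix ι ι ℝ} (hP : P.PosDef)
    (hle : ∀ z, (T *ᵥ z) ⬝ᵥ (P *ᵥ (T *ᵥ z)) ≤ z ⬝ᵥ (P *ᵥ z))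
    (hge : ∀ z, z ⬝ᵥ (P *ᵥ z) ≤ 2 * ((T *ᵥ z) ⬝ᵥ (P *ᵥ (T *ᵥ z)))) :
    IsUnit T ∧ energyCondNumber P T ≤ ENNReal.ofReal √2 ∧
      spectralCondNumber T ≤ ENNReal.ofReal √2 := by
  have hT : IsUnit T := by
    rw [Matrix.isUnit_iff_isUnit_det, isUnit_iff_ne_zero, Ne, ← Matrix.exists_mulVec_eq_zero_iff]
    rintro ⟨z, hz, hTz⟩
    have hpos : 0 < z ⬝ᵥ (P *ᵥ z) := by simpa using hP.dotProduct_mulVec_pos hz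
    have := hge z
    rw [hTz, zero_dotProduct] at this
    linarith
  have h1 : ∀ z, (T *ᵥ z) ⬝ᵥ (P *ᵥ (T *ᵥ z)) ≤ 1 ^ 2 * (z ⬝ᵥ (P *ᵥ z)) := by simpa using hle
  have h2 : ∀ z, (T⁻¹ *ᵥ z) ⬝ᵥ (P *ᵥ (T⁻¹ *ᵥ z)) ≤ √2 ^ 2 * (z ⬝ᵥ (P *ᵥ z)) := by
    intro z
    have := hge (T⁻¹ *ᵥ z)
    have hTT : T *ᵥ (T⁻¹ *ᵥ z) = z := by
      rw [Matrix.mulVec_mulVec, Matrix.mul_nonsing_inv _ ((Matrix.isUnit_iff_isUnit_det T).1 hT),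
        Matrix.one_mulVec]
    rwa [hTT, ← Real.sq_sqrt (zero_le_two (α := ℝ))] at this
  have hC : ENNReal.ofReal 1 * ENNReal.ofReal √2 = ENNReal.ofReal √2 := by simp
  refine ⟨hT, ?_, ?_⟩
  · rw [energyCondNumber, if_pos hT, ← hC]
    exact mul_le_mul' (energyOpNorm_le hP zero_le_one h1) (energyOpNorm_le hP (Real.sqrt_nonneg 2) h2)
  · rw [spectralCondNumber, if_pos hT, ← hC]
    exact mul_le_mul' (spectralRadius_map_le hP zero_le_one h1)
      (spectralRadius_map_le hP (Real.sqrt_nonneg 2) h2)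

end ConditionNumber

/-! ### Continuity and inf-sup stability of the block saddle-point form -/

section SaddlePoint

variable {ι : Type*} [Fintype ι]

/-- The block preconditioner with `η = r ^ 2`. -/
noncomputable def blockPrecond (K M : Matrix ι ι ℝ) (r : ℝ) : Matrix (ι ⊕ ι) (ι ⊕ ι) ℝ :=
  Matrix.fromBlocks (K + r⁻¹ • M) 0 0 (r ^ 2 • K + r • M)

/-- The saddle-point matrix with `η = r ^ 2`. -/
noncomputable def blockSaddle (K M : Matrix ι ι ℝ) (r : ℝ) : Matrix (ι ⊕ ι) (ι ⊕ ι) ℝ :=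
  Matrix.fromBlocks K M M (-(r ^ 2 • K))

theorem dotProduct_blockPrecond_mulVec (K M : Matrix ι ι ℝ) (r : ℝ) (x y u v : ι → ℝ) :
    Sum.elim x y ⬝ᵥ (blockPrecond K M r *ᵥ Sum.elim u v) =
      x ⬝ᵥ (K *ᵥ u) + r⁻¹ * (x ⬝ᵥ (M *ᵥ u)) + r ^ 2 * (y ⬝ᵥ (K *ᵥ v)) + r * (y ⬝ᵥ (M *ᵥ v)) := by
  simp [blockPrecond, Matrix.fromBlocks_mulVec, Matrix.add_mulVec, Matrix.smul_mulVec,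
    dotProduct_add]
  ring

theorem dotProduct_blockSaddle_mulVec (K M : Matrix ι ι ℝ) (r : ℝ) (x y u v : ι → ℝ) :
    Sum.elim x y ⬝ᵥ (blockSaddle K M r *ᵥ Sum.elim u v) =
      x ⬝ᵥ (K *ᵥ u) + x ⬝ᵥ (M *ᵥ v) + y ⬝ᵥ (M *ᵥ u) - r ^ 2 * (y ⬝ᵥ (K *ᵥ v)) := by
  simp [blockSaddle, Matrix.fromBlocks_mulVec, Matrix.neg_mulVec, Matrix.smul_mulVec,
    dotProduct_add]
  ring

variable {K M : Matrix ι ι ℝ} {r : ℝ}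

theorem posDef_blockPrecond (hK : K.PosSemidef) (hM : M.PosDef) (hr : 0 < r) :
    (blockPrecond K M r).PosDef := by
  have h1 : (K + r⁻¹ • M).PosDef := hM.smul (inv_pos.2 hr) |>.posSemidef_add hK
  have h2 : (r ^ 2 • K + r • M).PosDef := (hM.smul hr).posSemidef_add (hK.smul (sq_nonneg r))
  refine .of_dotProduct_mulVec_pos ?_ fun z hz => ?_
  · exact Matrix.IsHermitian.fromBlocks h1.isHermitian (by simp) h2.isHermitian
  · obtain ⟨x, y, rfl⟩ : ∃ x y, z = Sum.elim x y := ⟨_, _, (Sum.elim_comp_inl_inr z).symm⟩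
    have e : star (Sum.elim x y) ⬝ᵥ (blockPrecond K M r *ᵥ Sum.elim x y) =
        x ⬝ᵥ ((K + r⁻¹ • M) *ᵥ x) + y ⬝ᵥ ((r ^ 2 • K + r • M) *ᵥ y) := by
      simp [blockPrecond, Matrix.fromBlocks_mulVec]
    rw [e]
    have hx := dotProduct_mulVec_self_nonneg h1.posSemidef x
    have hy := dotProduct_mulVec_self_nonneg h2.posSemidef y
    by_cases h0 : x = 0
    · have hy0 : y ≠ 0 := by
        rintro rfl
        exact hz (by rw [h0]; funext i; cases i <;> rfl)
      have : 0 < y ⬝ᵥ ((r ^ 2 • K + r • M) *ᵥ y) := by simpa using h2.dotProduct_mulVec_pos hy0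
      linarith
    · have : 0 < x ⬝ᵥ ((K + r⁻¹ • M) *ᵥ x) := by simpa using h1.dotProduct_mulVec_pos h0
      linarith

/-- The saddle-point form is bounded by the energy norms. -/
theorem two_mul_dotProduct_blockSaddle_mulVec_le (hK : K.PosSemidef) (hM : M.PosSemidef)
    (hr : 0 < r) (w z : ι ⊕ ι → ℝ) :
    2 * (w ⬝ᵥ (blockSaddle K M r *ᵥ z)) ≤
      w ⬝ᵥ (blockPrecond K M r *ᵥ w) + z ⬝ᵥ (blockPrecond K M r *ᵥ z) := by
  obtain ⟨x, y, rfl⟩ : ∃ x y, w = Sum.elim x y := ⟨_, _, (Sum.elim_comp_inl_inr w).symm⟩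
  obtain ⟨u, v, rfl⟩ : ∃ u v, z = Sum.elim u v := ⟨_, _, (Sum.elim_comp_inl_inr z).symm⟩
  simp only [dotProduct_blockPrecond_mulVec, dotProduct_blockSaddle_mulVec]
  -- The weight -1 matches the sign of the lower `K` block. For the `M` blocks, weight r followed by
  -- division by r splits each coupling into the r⁻¹`M` and r`M` parts of the preconditioner.
  have h1 := two_mul_dotProduct_mulVec_le hK 1 x u
  have h2 := mul_le_mul_of_nonneg_left (two_mul_dotProduct_mulVec_le hK (-1) y v) (sq_nonneg r)
  have h3 := mul_le_mul_of_nonneg_left (two_mul_dotProduct_mulVec_le hM r x v)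
    (inv_pos.2 hr).le
  have h4 := mul_le_mul_of_nonneg_left (two_mul_dotProduct_mulVec_le hM r u y)
    (inv_pos.2 hr).le
  rw [dotProduct_mulVec_comm_of_isHermitian hM.isHermitian u y] at h4
  have e : ∀ a b : ℝ, r⁻¹ * (a + r ^ 2 * b) = r⁻¹ * a + r * b := fun a b => by field_simp
  have e' : ∀ a : ℝ, r⁻¹ * (2 * r * a) = 2 * a := fun a => by field_simp
  rw [e, e'] at h3 h4
  linarith

/-- The test vector `w = (x + r y, r⁻¹ x - y)` realizes the inf-sup condition at `z = (x, y)`. -/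
theorem exists_dotProduct_blockSaddle_mulVec_eq (hK : K.IsHermitian) (hM : M.IsHermitian)
    (hr : 0 < r) (z : ι ⊕ ι → ℝ) :
    ∃ w, w ⬝ᵥ (blockSaddle K M r *ᵥ z) = z ⬝ᵥ (blockPrecond K M r *ᵥ z) ∧
      w ⬝ᵥ (blockPrecond K M r *ᵥ w) = 2 * (z ⬝ᵥ (blockPrecond K M r *ᵥ z)) := by
  obtain ⟨x, y, rfl⟩ : ∃ x y, z = Sum.elim x y := ⟨_, _, (Sum.elim_comp_inl_inr z).symm⟩
  have hKxy := dotProduct_mulVec_comm_of_isHermitian hK x y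
  have hMxy := dotProduct_mulVec_comm_of_isHermitian hM x y
  -- Testing with (x, -y) recovers the `K` energy and with (r y, r⁻¹ x) the `M` energy; in the sum
  -- the cross terms cancel by symmetry, both in the pairing and in the energy of `w`.
  refine ⟨Sum.elim (x + r • y) (r⁻¹ • x - y), ?_, ?_⟩ <;>
  · simp only [dotProduct_blockPrecond_mulVec, dotProduct_blockSaddle_mulVec, Matrix.mulVec_sub,
      Matrix.mulVec_add, Matrix.mulVec_smul, sub_dotProduct, dotProduct_sub, add_dotProduct,
      dotProduct_add, smul_dotProduct, dotProduct_smul, smul_eq_mul, ← hKxy, ← hMxy]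
    field_simp
    ring

theorem isUnit_blockSaddle_and_condNumber_le [DecidableEq ι] (hK : K.PosSemidef) (hM : M.PosDef)
    (hr : 0 < r) :
    IsUnit (blockSaddle K M r) ∧
      energyCondNumber (blockPrecond K M r) ((blockPrecond K M r)⁻¹ * blockSaddle K M r) ≤
        ENNReal.ofReal √2 ∧
      spectralCondNumber ((blockPrecond K M r)⁻¹ * blockSaddle K M r) ≤ ENNReal.ofReal √2 := by
  have hP := posDef_blockPrecond hK hM hr
  set P := blockPrecond K M r with hPdef
  set A := blockSaddle K M r with hA
  have hPT : P * (P⁻¹ * A) = A :=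
    Matrix.mul_nonsing_inv_cancel_left _ _ ((Matrix.isUnit_iff_isUnit_det P).1 hP.isUnit)
  have hPTz : ∀ z, P *ᵥ ((P⁻¹ * A) *ᵥ z) = A *ᵥ z := fun z => by
    rw [Matrix.mulVec_mulVec, hPT]
  obtain ⟨hT, h1, h2⟩ := isUnit_and_condNumber_le (T := P⁻¹ * A) hP
    (fun z => by
      -- With w = Tz the left side is 2‖Tz‖², and one copy is absorbed.
      have h := two_mul_dotProduct_blockSaddle_mulVec_le hK hM.posSemidef hr ((P⁻¹ * A) *ᵥ z) z
      rw [← hPdef, ← hA, hPTz] at h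
      rw [hPTz]
      linarith)
    (fun z => by
      obtain ⟨w, hw, hw'⟩ :=
        exists_dotProduct_blockSaddle_mulVec_eq hK.isHermitian hM.isHermitian hr z
      rw [← hPdef, ← hA] at hw
      rw [← hPdef] at hw'
      -- This reads 4‖z‖² ≤ 2‖z‖² + 4‖Tz‖²; the weight 2 is the optimal one.
      have h := two_mul_dotProduct_mulVec_le hP.posSemidef 2 w ((P⁻¹ * A) *ᵥ z)
      rw [hPTz, hw, hw'] at h
      rw [hPTz]
      linarith)
  refine ⟨?_, h1, h2⟩
  rw [← hPT]
  exact hP.isUnit.mul hT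

end SaddlePoint

/-! ### Topology and measure of the unit square, and L² Gram matrices -/

theorem isOpen_unitSquare : IsOpen unitSquare := by
  have h : unitSquare = ⋂ i, (fun x : Plane => x i) ⁻¹' Set.Ioo 0 1 := by
    ext x
    simp [unitSquare]
  rw [h]
  exact isOpen_iInter_of_finite fun i =>
    isOpen_Ioo.preimage (EuclideanSpace.proj (𝕜 := ℝ) i).continuous

theorem unitSquare_subset_closedUnitSquare : unitSquare ⊆ closedUnitSquare :=
  fun _ hx i => ⟨(hx i).1.le, (hx i).2.le⟩

/-- Moving a point slightly towards the centre puts it in the open square. -/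
theorem closedUnitSquare_subset_closure_unitSquare : closedUnitSquare ⊆ closure unitSquare := by
  intro x hx
  have ht : Filter.Tendsto
      (fun t : ℝ => (1 - t) • x + t • (WithLp.toLp 2 (fun _ => 1 / 2) : Plane))
      (nhdsWithin 0 (Set.Ioo 0 1)) (nhds x) := by
    have hc : Continuous
        (fun t : ℝ => (1 - t) • x + t • (WithLp.toLp 2 (fun _ => 1 / 2) : Plane)) := by fun_prop
    simpa using (hc.tendsto 0).mono_left nhdsWithin_le_nhds
  have hne : (nhdsWithin (0 : ℝ) (Set.Ioo 0 1)).NeBot := by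
    rw [← mem_closure_iff_nhdsWithin_neBot, closure_Ioo zero_ne_one]
    simp
  refine mem_closure_of_tendsto ht ?_
  filter_upwards [self_mem_nhdsWithin] with t ht i
  have h0 := mul_nonneg (sub_nonneg.2 ht.2.le) (hx i).1
  have h1 := mul_nonneg (sub_nonneg.2 ht.2.le) (sub_nonneg.2 (hx i).2)
  have h2 := ht.1
  simp only [PiLp.add_apply, PiLp.smul_apply, smul_eq_mul]
  constructor <;> linarith

theorem isCompact_closedUnitSquare : IsCompact closedUnitSquare := by
  have : closedUnitSquare =
      (EuclideanSpace.equiv (Fin 2) ℝ).toHomeomorph ⁻¹' Set.Icc (fun _ => 0) (fun _ => 1) := by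
    ext x
    simp [closedUnitSquare, Pi.le_def, forall_and]
  rw [this, Homeomorph.isCompact_preimage]
  exact isCompact_Icc

/-- Finiteness puts the bounded hats and their bounded gradients in L². -/
instance isFiniteMeasure_restrict_unitSquare :
    IsFiniteMeasure (volume.restrict unitSquare : Measure Plane) :=
  isFiniteMeasure_restrict.2 <| ne_top_of_le_ne_top isCompact_closedUnitSquare.measure_ne_top
    (measure_mono unitSquare_subset_closedUnitSquare)

theorem of_integral_inner_eq_gram {α ι E : Type*} [MeasurableSpace α] {μ : Measure α}
    [NormedAddCommGroup E] [InnerProductSpace ℝ E] {f : ι → α → E} (hf : ∀ i, MemLp (f i) 2 μ) :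
    (Matrix.of fun i j => ∫ x, inner ℝ (f i x) (f j x) ∂μ) =
      Matrix.gram ℝ fun i => (hf i).toLp (f i) := by
  ext i j
  rw [Matrix.gram_apply, L2.inner_def]
  refine integral_congr_ae ?_
  filter_upwards [(hf i).coeFn_toLp, (hf j).coeFn_toLp] with x hi hj
  rw [hi, hj]

/-! ### Definiteness of the finite element matrices -/

namespace Triangulation

variable (𝒯 : Triangulation)

theorem continuousOn_hat (p : 𝒯.Node) : ContinuousOn (𝒯.hat p) closedUnitSquare :=
  (𝒯.hat_mem_linearElements p).1

theorem node_mem_closedUnitSquare (p : 𝒯.Node) : (p : Plane) ∈ closedUnitSquare := by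
  rw [← 𝒯.space_eq]
  exact 𝒯.complex.subset_space p.2 (by simp)

theorem memLp_hat (p : 𝒯.Node) : MemLp (𝒯.hat p) 2 (volume.restrict unitSquare) := by
  obtain ⟨C, hC⟩ := isCompact_closedUnitSquare.exists_bound_of_continuousOn (𝒯.continuousOn_hat p)
  refine MemLp.of_bound (((𝒯.continuousOn_hat p).mono
    unitSquare_subset_closedUnitSquare).aestronglyMeasurable isOpen_unitSquare.measurableSet) C ?_
  filter_upwards [ae_restrict_mem isOpen_unitSquare.measurableSet] with x hx
  exact hC x (unitSquare_subset_closedUnitSquare hx)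

/-- A combination that vanishes almost everywhere vanishes on the open square by continuity, then on
the closed square by density. The closure is needed because nodes may lie on the boundary;
evaluation at a node isolates its coefficient. -/
theorem linearIndependent_toLp_hat :
    LinearIndependent ℝ fun p => (𝒯.memLp_hat p).toLp (𝒯.hat p) := by
  rw [Fintype.linearIndependent_iff]
  intro c hc q
  have hae : (fun x => ∑ p, c p * 𝒯.hat p x) =ᵐ[volume.restrict unitSquare] fun _ => 0 := by
    have h0 := Lp.coeFn_zero ℝ 2 (volume.restrict unitSquare : Measure Plane)
    rw [← hc] at h0
    have hp : ∀ᵐ x ∂(volume.restrict unitSquare : Measure Plane), ∀ p,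
        (c p • (𝒯.memLp_hat p).toLp (𝒯.hat p) : Lp ℝ 2 _) x = c p * 𝒯.hat p x := by
      refine ae_all_iff.2 fun p => ?_
      filter_upwards [Lp.coeFn_smul (c p) ((𝒯.memLp_hat p).toLp (𝒯.hat p)),
        (𝒯.memLp_hat p).coeFn_toLp] with x h1 h2
      rw [h1, Pi.smul_apply, h2, smul_eq_mul]
    filter_upwards [h0, Lp.coeFn_fun_finsetSum Finset.univ fun p => c p • (𝒯.memLp_hat p).toLp (𝒯.hat p), hp]
      with x h0 hs hp
    rw [hs] at h0
    simpa [hp] using h0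
  have hcont : ContinuousOn (fun x => ∑ p, c p * 𝒯.hat p x) closedUnitSquare :=
    continuousOn_finsetSum _ fun p _ => continuousOn_const.mul (𝒯.continuousOn_hat p)
  have hzero := (Measure.eqOn_open_of_ae_eq hae isOpen_unitSquare
    (hcont.mono unitSquare_subset_closedUnitSquare) continuousOn_const).of_subset_closure
      hcont continuousOn_const unitSquare_subset_closedUnitSquare
      closedUnitSquare_subset_closure_unitSquare
  simpa [hat_node] using hzero (𝒯.node_mem_closedUnitSquare q)

theorem posDef_mass : 𝒯.mass.PosDef := by
  have h : 𝒯.mass = Matrix.gram ℝ fun p => (𝒯.memLp_hat p).toLp (𝒯.hat p) := by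
    rw [← of_integral_inner_eq_gram]
    ext p q
    simp [mass, mul_comm]
  rw [h]
  exact Matrix.posDef_gram_of_linearIndependent 𝒯.linearIndependent_toLp_hat

/-- Frontiers of convex sets are null and there are finitely many faces, so almost every point is
interior to a face containing it. Near such a point the hat is affine, and summing the slopes over
all faces bounds each one. -/
theorem exists_norm_gradient_hat_le (p : 𝒯.Node) :
    ∃ C, ∀ᵐ x ∂volume.restrict unitSquare, ‖gradient (𝒯.hat p) x‖ ≤ C := by
  choose! a ha using fun s (hs : s ∈ 𝒯.complex.faces) => 𝒯.hat_affine p hs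
  refine ⟨∑ s ∈ 𝒯.finite_faces.toFinset, ‖(a s).linear.toContinuousLinearMap‖, ?_⟩
  have hfr : ∀ᵐ x ∂volume.restrict unitSquare, ∀ s ∈ 𝒯.complex.faces,
      x ∉ frontier (convexHull ℝ (s : Set Plane)) :=
    ae_restrict_of_ae <| (ae_ball_iff 𝒯.finite_faces.countable).2 fun s _ =>
      measure_eq_zero_iff_ae_notMem.1 ((convex_convexHull ℝ _).addHaar_frontier volume)
  filter_upwards [hfr, ae_restrict_mem isOpen_unitSquare.measurableSet] with x hx hxΩ
  have hxs := unitSquare_subset_closedUnitSquare hxΩ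
  rw [← 𝒯.space_eq, Geometry.SimplicialComplex.mem_space_iff] at hxs
  obtain ⟨s, hs, hxs⟩ := hxs
  have hint : x ∈ interior (convexHull ℝ (s : Set Plane)) := by
    by_contra hcon
    exact hx s hs ⟨subset_closure hxs, hcon⟩
  have heq : 𝒯.hat p =ᶠ[nhds x] a s :=
    (ha s hs).eventuallyEq_of_mem (mem_interior_iff_mem_nhds.1 hint)
  have hfd : HasFDerivAt (a s) (a s).linear.toContinuousLinearMap x := by
    have hd : (a s : Plane → ℝ) = fun y => (a s).linear.toContinuousLinearMap y + a s 0 := by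
      funext y
      simpa using congrFun (a s).decomp y
    rw [hd]
    exact (ContinuousLinearMap.hasFDerivAt _).add_const _
  rw [gradient, LinearIsometryEquiv.norm_map, heq.fderiv_eq, hfd.fderiv]
  exact Finset.single_le_sum
    (f := fun s => ‖(a s).linear.toContinuousLinearMap‖) (fun _ _ => norm_nonneg _)
    (𝒯.finite_faces.mem_toFinset.2 hs)

theorem memLp_gradient_hat (p : 𝒯.Node) :
    MemLp (gradient (𝒯.hat p)) 2 (volume.restrict unitSquare) := by
  obtain ⟨C, hC⟩ := 𝒯.exists_norm_gradient_hat_le p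
  have hmeas : Measurable (gradient (𝒯.hat p)) :=
    (InnerProductSpace.toDual ℝ Plane).symm.continuous.measurable.comp (measurable_fderiv ℝ _)
  exact MemLp.of_bound hmeas.aestronglyMeasurable C hC

theorem posSemidef_stiffness : 𝒯.stiffness.PosSemidef := by
  rw [stiffness, of_integral_inner_eq_gram fun p => 𝒯.memLp_gradient_hat p]
  exact Matrix.posSemidef_gram ℝ _

theorem posSemidef_stiffnessBar : 𝒯.stiffnessBar.PosSemidef :=
  𝒯.posSemidef_stiffness.add (by simpa using Matrix.posSemidef_vecMulVec_self_star 𝒯.meanVec)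

/-- Setting r = √η turns the real powers of η into r⁻¹, r and r², which suit `field_simp` and
`ring`. -/
theorem precond_eq_blockPrecond {η : ℝ} (hη : 0 < η) :
    𝒯.precond η = blockPrecond 𝒯.stiffnessBar 𝒯.mass √η := by
  rw [precond, blockPrecond, Real.sq_sqrt hη.le, Real.rpow_neg hη.le, ← Real.sqrt_eq_rpow]

theorem saddle_eq_blockSaddle {η : ℝ} (hη : 0 < η) :
    𝒯.saddle η = blockSaddle 𝒯.stiffnessBar 𝒯.mass √η := by
  rw [saddle, blockSaddle, Real.sq_sqrt hη.le]

end Triangulation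

end CahnHilliardFEM


theorem mainTheorem1 :
    ∃ C : ℝ≥0, ∀ (𝒯 : CahnHilliardFEM.Triangulation) (η : ℝ), 0 < η →
      (𝒯.precond η).PosDef ∧
      IsUnit (𝒯.saddle η) ∧
      CahnHilliardFEM.energyCondNumber (𝒯.precond η) (𝒯.preconditioned η) ≤ C ∧
      CahnHilliardFEM.spectralCondNumber (𝒯.preconditioned η) ≤ C := by
  refine ⟨(√2).toNNReal, fun 𝒯 η hη => ?_⟩
  have hr : 0 < √η := Real.sqrt_pos.2 hη
  rw [CahnHilliardFEM.Triangulation.preconditioned, 𝒯.precond_eq_blockPrecond hη,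
    𝒯.saddle_eq_blockSaddle hη]
  exact ⟨CahnHilliardFEM.posDef_blockPrecond 𝒯.posSemidef_stiffnessBar 𝒯.posDef_mass hr,
    CahnHilliardFEM.isUnit_blockSaddle_and_condNumber_le 𝒯.posSemidef_stiffnessBar
      𝒯.posDef_mass hr⟩
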